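/- Let $k$ be a finite field with $q$ elements and fix a nontrivial additive character $\psi_0$ of $k$ with values in the unit circle. For $f:k\to\mathbf{C}$ put $\widehat f(a)=\sum_{x\in k}f(x)\psi_0(ax)$ and $\|\widehat f\|_1=\sum_{a\in k}|\widehat f(a)|$. A distribution on $k$ is a function $\mu:k\to\mathbf{R}_{\ge 0}$ with $\sum_{x\in k}\mu(x)=1$. For integers $m,n\ge 0$ with $2m\le n+1$ let $H_m\subseteq k^{n+1}$ be the set of sequences $(x_0,\ldots,x_n)$ for which there exist $a_0,\ldots,a_m\in k$, not all zero, such that $\sum_{i=0}^m a_ix_{i+j}=0$ for each $j=0,1,\ldots,n-m$. For distributions $\mu_0,\ldots,\mu_n$ on $k$ let $$\Pi_m(\mu_0,\ldots,\mu_n)=\sum_{x\in H_m}\prod_{i=0}^n\mu_i(x_i)$$ be the probability that $(x_0,\ldots,x_n)\in H_m$ when the $x_i$ are independent with $x_i\sim\mu_i$. **Theorem 2.** For every $q$ and every real $\varepsilon>0$ there is an effective constant $C$, depending only on $q$ and $\varepsilon$, such that $$\left|\Pi_m(\mu_0,\ldots,\mu_n)-q^{2m-(n+1)}\right|<C(1+\varepsilon)^n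 q^{m-n}\prod_{i=0}^n\|\widehat\mu_i\|_1$$ for all integers $m,n\ge 0$ with $2m\le n+1$ and all distributions $\mu_0,\ldots,\mu_n$ on $k$. Here effective means that there is a computable function $(q,N)\mapsto C(q,N)\in\mathbf{N}$ such that $C=C(q,N)$ has this property whenever $N$ is a positive integer with $1/N\le\varepsilon$. Consequently, let $\mu$ be a distribution on $k$ with $\|\widehat\mu\|_1<q^{1/2}$. Then, for each fixed integer $\alpha\ge 0$, if $x_0,\ldots,x_{2m+\alpha}$ are chosen independently from $\mu$, the probability that $(x_0,\ldots,x_{2m+\alpha})\in H_m$ tends to $q^{-(\alpha+1)}$ as $m\to\infty$. In particular (the case $\alpha=0$), the probability that the square Hankel matrix $(x_{i+j})_{0\le i,j\le m}$ of order $m+1$ with independent entries $x_0,\ldots,x_{2m}\sim\mu$ is singular tends to $1/q$ as $m\to\infty$. -/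

import Mathlib

universe u

noncomputable section

namespace LinRec

/-- The set `H_m` of sequences `(x_0, …, x_n)` satisfying a linear recursion of degree `m`:
there are `a_0, …, a_m`, not all zero, with `∑ i, a_i * x_(i+j) = 0` for `0 ≤ j ≤ n - m`. -/
def H (k : Type*) [Field k] (m n : ℕ) : Set (Fin (n + 1) → k) :=
  {x | ∃ a : Fin (m + 1) → k, a ≠ 0 ∧
    ∀ (j : ℕ) (hj : j + m ≤ n),
      ∑ i : Fin (m + 1), a i * x ⟨(i : ℕ) + j, by have := i.isLt; omega⟩ = 0}

/-- The square Hankel matrix of order `m + 1` with entries `x_0, …, x_(2m)`. -/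
def hankel {k : Type*} (m : ℕ) (x : Fin (2 * m + 1) → k) :
    Matrix (Fin (m + 1)) (Fin (m + 1)) k :=
  Matrix.of fun i j => x ⟨(i : ℕ) + (j : ℕ), by have := i.isLt; have := j.isLt; omega⟩

/-- A probability distribution on a finite set, given by its weights. -/
structure IsDistribution {k : Type*} [Fintype k] (μ : k → ℝ) : Prop where
  nonneg : ∀ x, 0 ≤ μ x
  sum_eq_one : ∑ x, μ x = 1

/-- The probability that `(x_i)` lies in `S` when the `x_i` are independent with
distributions `μ_i`. -/
def prob {ι k : Type*} [Fintype ι] [DecidableEq ι] [Fintype k]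
    (μ : ι → k → ℝ) (S : Set (ι → k)) : ℝ :=
  ∑ x : ι → k, S.indicator (fun x => ∏ i, μ i (x i)) x

/-- The discrete Fourier transform `f̂ a = ∑ x, f x * ψ (a * x)`. -/
def fourier {k : Type*} [Field k] [Fintype k] (ψ : AddChar k Circle) (f : k → ℂ) (a : k) : ℂ :=
  ∑ x : k, f x * (ψ (a * x) : ℂ)

/-- The `l₁` norm of the Fourier transform of a real-valued function `μ` on `k`. -/
def fourierL1 {k : Type*} [Field k] [Fintype k] (ψ : AddChar k Circle) (μ : k → ℝ) : ℝ :=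
  ∑ a : k, ‖fourier ψ (fun x => (μ x : ℂ)) a‖

end LinRec

end

open Polynomial Module

noncomputable section

namespace LinRec

/-! ### Dimensions of recursion spaces along an antidiagonal. -/

section Recursions

variable {k : Type*} [Field k] (Λ : k[X] →ₗ[k] k)

/-! Read a sequence `x` as a functional `Λ` on polynomials of degree at most `n`, and let `d(p, r)`
be the dimension of `recursions Λ p r`. With `m + r = n + 1`, membership in `H_m` means `d(m+1, r) ≠
0`. Along `p + r = const` the function `d` is convex, vanishes at `p = 0`, and has a reflection
symmetry; hence for `m ≤ r` a nonzero `d(m+1, r)` equals `d(m, r+1) + 1`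
(`finrank_recursions_succ`). So `q^r (q^d(m+1,r) - 1) - q^(r+1) (q^d(m,r+1) - 1)` is `(q - 1) q^r`
on `H_m` and `0` elsewhere.

By orthogonality of characters, each of the two terms is a sum of `ψ (Λ (a * b))` over pairs with `a
≠ 0` (`indicator_H_eq_sum_char`). Averaging over `x` replaces `ψ (Λ c)` by the product of the
Fourier coefficients at the coefficients of `c`. The pairs with `b = 0` give the main term
`q^(m-r)`. In the others `c = a * b` is nonzero of degree at most `n`, and is hit at most as often
as it has divisors, which is `O((1+ε)^n)` (`exists_finset_dvd_card_le`); summing over all `c` gives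
the product of the `l₁` norms. -/

/-- The pairing `(a, b) ↦ Λ (a * b)` between polynomials of degree `< p` and `< r`. -/
def pairing (p r : ℕ) : degreeLT k p →ₗ[k] Dual k (degreeLT k r) :=
  ((LinearMap.mul k k[X]).compr₂ Λ).domRestrict₁₂ (degreeLT k p) (degreeLT k r)

@[simp]
theorem pairing_apply (p r : ℕ) (a : degreeLT k p) (b : degreeLT k r) :
    pairing Λ p r a b = Λ (a * b) := rfl

/-- The polynomials of degree `< p` that are orthogonal under `Λ` to the products with all
polynomials of degree `< r`. -/
def recursions (p r : ℕ) : Submodule k k[X] :=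
  (LinearMap.ker (pairing Λ p r)).map (degreeLT k p).subtype

variable {Λ}

theorem mem_recursions {p r : ℕ} {a : k[X]} :
    a ∈ recursions Λ p r ↔ a ∈ degreeLT k p ∧ ∀ b ∈ degreeLT k r, Λ (a * b) = 0 := by
  simp only [recursions, Submodule.mem_map, LinearMap.mem_ker]
  constructor
  · rintro ⟨a, ha, rfl⟩
    exact ⟨a.2, fun b hb => LinearMap.congr_fun ha ⟨b, hb⟩⟩
  · rintro ⟨ha, h⟩
    exact ⟨⟨a, ha⟩, LinearMap.ext fun b => h b b.2, rfl⟩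

theorem recursions_le_degreeLT (p r : ℕ) : recursions Λ p r ≤ degreeLT k p :=
  fun _ ha => (mem_recursions.1 ha).1

instance finiteDimensional_recursions (p r : ℕ) : FiniteDimensional k (recursions Λ p r) :=
  Submodule.finiteDimensional_of_le (recursions_le_degreeLT p r)

theorem finrank_degreeLT (p : ℕ) : finrank k (degreeLT k p) = p := by
  simpa using finrank_eq_card_basis (degreeLT.basis k p)

theorem X_mul_mem_degreeLT {p : ℕ} {a : k[X]} : X * a ∈ degreeLT k (p + 1) ↔ a ∈ degreeLT k p := by
  rcases eq_or_ne a 0 with rfl | ha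
  · simp
  · rw [mem_degreeLT, mem_degreeLT, degree_mul, degree_X, degree_eq_natDegree ha]
    norm_cast
    omega

theorem mul_mem_degreeLT {p r s : ℕ} (h : p + r ≤ s + 1) {a b : k[X]} (ha : a ∈ degreeLT k p)
    (hb : b ∈ degreeLT k r) : a * b ∈ degreeLT k s := by
  rcases eq_or_ne a 0 with rfl | ha0
  · simp
  rcases eq_or_ne b 0 with rfl | hb0
  · simp
  rw [mem_degreeLT, degree_eq_natDegree ha0] at ha
  rw [mem_degreeLT, degree_eq_natDegree hb0] at hb
  rw [mem_degreeLT, degree_eq_natDegree (mul_ne_zero ha0 hb0), natDegree_mul ha0 hb0]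
  norm_cast at *
  omega

theorem divX_mem_degreeLT {p : ℕ} {a : k[X]} (ha : a ∈ degreeLT k (p + 1)) :
    a.divX ∈ degreeLT k p := by
  rw [mem_degreeLT, degree_lt_iff_coeff_zero] at *
  intro i hi
  rw [coeff_divX]
  exact ha _ (by omega)

variable (Λ)

/-- A bilinear form and its transpose have the same rank; rank–nullity on both sides gives the
symmetry. -/
theorem finrank_recursions_comm (p r : ℕ) :
    finrank k (recursions Λ p r) + r = finrank k (recursions Λ r p) + p := by
  have h0 : ∀ p r : ℕ, finrank k (LinearMap.range (pairing Λ p r)) +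
      finrank k (recursions Λ p r) = p := by
    intro p r
    rw [recursions, Submodule.finrank_map_subtype_eq, LinearMap.finrank_range_add_finrank_ker,
      finrank_degreeLT]
  have h3 : pairing Λ r p = (pairing Λ p r).dualMap ∘ₗ (evalEquiv k (degreeLT k r)).toLinearMap := by
    ext b a
    simp [mul_comm]
  have h4 : LinearMap.range (pairing Λ r p) = LinearMap.range (pairing Λ p r).dualMap := by
    rw [h3, LinearMap.range_comp_of_range_eq_top _ (LinearEquiv.range _)]
  have h1 := h0 p r
  have h2 := h0 r p
  rw [h4, LinearMap.finrank_range_dualMap_eq_finrank_range] at h2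
  omega

/-- Convexity. `A` and `X * A` have the same dimension; their sum lies in the next recursion space,
and their intersection lies in `X` times the previous one. -/
theorem two_mul_finrank_recursions_le (p r : ℕ) :
    2 * finrank k (recursions Λ (p + 1) (r + 1)) ≤
      finrank k (recursions Λ p (r + 2)) + finrank k (recursions Λ (p + 2) r) := by
  set A := recursions Λ (p + 1) (r + 1)
  let φ : k[X] →ₗ[k] k[X] := LinearMap.mulLeft k X
  have hφ : Function.Injective φ := fun a b h => mul_left_cancel₀ X_ne_zero h
  have hsup : A.map φ ⊔ A ≤ recursions Λ (p + 2) r := by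
    refine sup_le ?_ fun c hc => ?_
    · rintro _ ⟨b, hb, rfl⟩
      obtain ⟨hb, hb'⟩ := mem_recursions.1 hb
      refine mem_recursions.2 ⟨X_mul_mem_degreeLT.2 hb, fun e he => ?_⟩
      rw [← hb' (X * e) (X_mul_mem_degreeLT.2 he), LinearMap.mulLeft_apply]
      congr 1
      ring
    · obtain ⟨hc, hc'⟩ := mem_recursions.1 hc
      exact mem_recursions.2 ⟨degreeLT_mono (by omega) hc,
        fun e he => hc' e (degreeLT_mono (by omega) he)⟩
  have hinf : A.map φ ⊓ A ≤ (recursions Λ p (r + 2)).map φ := by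
    rintro _ ⟨⟨b, hb, rfl⟩, hc⟩
    obtain ⟨hb, hb'⟩ := mem_recursions.1 hb
    obtain ⟨hc, hc'⟩ := mem_recursions.1 hc
    refine ⟨b, mem_recursions.2 ⟨X_mul_mem_degreeLT.1 hc, fun e he => ?_⟩, rfl⟩
    have h3 := hc' _ (divX_mem_degreeLT he)
    have h4 := hb' (C (e.coeff 0)) (mem_degreeLT.2 (degree_C_le.trans_lt (by norm_cast; omega)))
    -- Split `e` into a multiple of `X` and a constant: the first part is killed because `X * b ∈
    -- A`, the second because `b ∈ A`.
    rw [← divX_mul_X_add e, mul_add, map_add, h4, add_zero, ← h3, LinearMap.mulLeft_apply]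
    congr 1
    ring
  have h1 := Submodule.finrank_sup_add_finrank_inf_eq (A.map φ) A
  have h2 := Submodule.finrank_mono hsup
  have h3 := Submodule.finrank_mono hinf
  rw [← (Submodule.equivMapOfInjective φ hφ A).finrank_eq] at h1
  rw [← (Submodule.equivMapOfInjective φ hφ _).finrank_eq] at h3
  omega

theorem recursions_mono (p r : ℕ) : recursions Λ p (r + 1) ≤ recursions Λ (p + 1) r := by
  intro a ha
  obtain ⟨ha, ha'⟩ := mem_recursions.1 ha
  exact mem_recursions.2 ⟨degreeLT_mono (by omega) ha,
    fun b hb => ha' b (degreeLT_mono (by omega) hb)⟩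

theorem finrank_recursions_succ {p r : ℕ} (hpr : p ≤ r)
    (h : finrank k (recursions Λ (p + 1) r) ≠ 0) :
    finrank k (recursions Λ (p + 1) r) = finrank k (recursions Λ p (r + 1)) + 1 := by
  set s := p + 1 + r with hs
  let f : ℕ → ℤ := fun i => finrank k (recursions Λ i (s - i))
  have hf : ∀ i j, i + j = s → (finrank k (recursions Λ i j) : ℤ) = f i := by
    intro i j hij
    obtain rfl : j = s - i := by omega
    rfl
  have hconv : ∀ i, i + 2 ≤ s → 2 * f (i + 1) ≤ f i + f (i + 2) := by
    intro i hi
    obtain ⟨j, hj⟩ := Nat.exists_eq_add_of_le hi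
    rw [← hf (i + 1) (j + 1) (by omega), ← hf i (j + 2) (by omega), ← hf (i + 2) j (by omega)]
    exact_mod_cast two_mul_finrank_recursions_le Λ i j
  have hmono : ∀ d i, i + d + 1 ≤ s → f (i + 1) - f i ≤ f (i + d + 1) - f (i + d) := by
    intro d
    induction d with
    | zero => intro i _; simp
    | succ d ih =>
      intro i hi
      have h1 := ih i (by omega)
      have h2 := hconv (i + d) (by omega)
      have e1 : i + (d + 1) + 1 = i + d + 2 := by ring
      have e2 : i + (d + 1) = i + d + 1 := by ring
      rw [e1, e2]
      linarith
  have hsymm : ∀ i j, i + j = s → f i + j = f j + i := by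
    intro i j hij
    rw [← hf i j hij, ← hf j i (by omega)]
    exact_mod_cast finrank_recursions_comm Λ i j
  have h0 : f 0 = 0 := by
    have := Submodule.finrank_mono (recursions_le_degreeLT (Λ := Λ) 0 (s - 0))
    rw [finrank_degreeLT] at this
    simp only [f]
    omega
  have hp1 := hf (p + 1) r rfl
  have hp0 := hf p (r + 1) (by omega)
  -- By symmetry the slopes at `p` and at `r` add up to 2; by convexity the one at `p ≤ r` is the
  -- smaller.
  have hupper : f (p + 1) - f p ≤ 1 := by
    obtain ⟨d, rfl⟩ := Nat.exists_eq_add_of_le hpr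
    have h1 := hmono d p (by omega)
    have h2 := hsymm p (p + d + 1) (by omega)
    have h3 := hsymm (p + 1) (p + d) (by omega)
    push_cast at h2 h3
    linarith
  -- Were this slope at most 0, so would be all earlier ones, and `f (p + 1) ≤ f 0 = 0`.
  have hlower : 1 ≤ f (p + 1) - f p := by
    by_contra! hlt
    have : ∀ i, i ≤ p + 1 → f i ≤ 0 := by
      intro i
      induction i with
      | zero => simp [h0]
      | succ i ih =>
        intro hi
        have h1 := ih (by omega)
        have h2 := hmono (p - i) i (by omega)
        rw [show i + (p - i) = p by omega] at h2
        omega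
    have := this (p + 1) le_rfl
    omega
  omega

end Recursions

/-! ### The divisor bound in `k[X]`. -/

section Divisors

variable {k : Type*} [Field k] [Fintype k]

instance fintypeDegreeLT (p : ℕ) : Fintype (degreeLT k p) :=
  Fintype.ofEquiv _ (degreeLTEquiv k p).symm.toEquiv

theorem card_degreeLT (p : ℕ) : Fintype.card (degreeLT k p) = Fintype.card k ^ p := by
  rw [Fintype.card_congr (degreeLTEquiv k p).toEquiv]
  simp

open Classical in
/-- The monic irreducible factors of degree `< N` of a polynomial. -/
def smallFactors (N : ℕ) (c : k[X]) : Finset k[X] :=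
  (Finset.univ.image (Subtype.val : degreeLT k N → k[X])).filter
    fun P => P.Monic ∧ Prime P ∧ P ∣ c

theorem mem_smallFactors {N : ℕ} {c P : k[X]} :
    P ∈ smallFactors N c ↔ P ∈ degreeLT k N ∧ P.Monic ∧ Prime P ∧ P ∣ c := by
  simp [smallFactors]

theorem card_smallFactors_le (N : ℕ) (c : k[X]) :
    (smallFactors N c).card ≤ Fintype.card k ^ N := by
  classical
  refine (Finset.card_filter_le _ _).trans (Finset.card_image_le.trans ?_)
  rw [Finset.card_univ, card_degreeLT]

theorem card_smallFactors_mul_of_isRelPrime (N : ℕ) {x y : k[X]} (h : IsRelPrime x y) :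
    (smallFactors N x).card + (smallFactors N y).card ≤ (smallFactors N (x * y)).card := by
  classical
  rw [← Finset.card_union_of_disjoint]
  · refine Finset.card_le_card (Finset.union_subset ?_ ?_) <;> intro P hP <;>
      obtain ⟨h1, h2, h3, h4⟩ := mem_smallFactors.1 hP
    · exact mem_smallFactors.2 ⟨h1, h2, h3, h4.mul_right _⟩
    · exact mem_smallFactors.2 ⟨h1, h2, h3, h4.mul_left _⟩
  · refine Finset.disjoint_left.2 fun P hx hy => ?_
    obtain ⟨-, -, h3, h4⟩ := mem_smallFactors.1 hx
    exact h3.not_isUnit (h h4 (mem_smallFactors.1 hy).2.2.2)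

theorem succ_le_mul_one_add_inv_pow {N : ℕ} (hN : 1 ≤ N) (i : ℕ) :
    (i + 1 : ℝ) ≤ N * (1 + 1 / (N : ℝ)) ^ i := by
  have hN' : (1 : ℝ) ≤ N := by exact_mod_cast hN
  have h := one_add_mul_le_pow (a := 1 / (N : ℝ)) (by have : 0 ≤ 1 / (N : ℝ) := by positivity
                                                      linarith) i
  calc (i + 1 : ℝ) ≤ N * (1 + i * (1 / (N : ℝ))) := by field_simp; linarith
    _ ≤ _ := by gcongr

theorem two_le_one_add_inv_pow {N : ℕ} (hN : 1 ≤ N) : (2 : ℝ) ≤ (1 + 1 / (N : ℝ)) ^ N := by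
  have hN' : (1 : ℝ) ≤ N := by exact_mod_cast hN
  have h := one_add_mul_le_pow (a := 1 / (N : ℝ)) (by have : 0 ≤ 1 / (N : ℝ) := by positivity
                                                      linarith) N
  rw [mul_one_div_cancel (by positivity)] at h
  linarith

/-- The divisor count is multiplicative, and a prime power `p ^ i` contributes `i + 1`. Only primes
of degree below `N` cost an extra factor `N`, and their number is bounded independently of `c`. -/
theorem exists_finset_monic_dvd_card_le_smallFactors {N : ℕ} (hN : 1 ≤ N) (c : k[X]) (hc : c ≠ 0) :
    ∃ T : Finset k[X], (∀ a : k[X], a.Monic → a ∣ c → a ∈ T) ∧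
      (T.card : ℝ) ≤ (N : ℝ) ^ (smallFactors N c).card * (1 + 1 / (N : ℝ)) ^ c.natDegree := by
  classical
  have hN' : (1 : ℝ) ≤ N := by exact_mod_cast hN
  have hb : (1 : ℝ) ≤ 1 + 1 / (N : ℝ) := by
    have : 0 ≤ 1 / (N : ℝ) := by positivity
    linarith
  induction c using UniqueFactorizationMonoid.induction_on_coprime with
  | h0 => exact absurd rfl hc
  | @h1 x hx =>
    refine ⟨{1}, fun a ha hax => ?_, ?_⟩
    · simpa using ha.eq_one_of_isUnit (isUnit_of_dvd_unit hax hx)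
    · simpa using one_le_mul_of_one_le_of_one_le (one_le_pow₀ hN') (one_le_pow₀ hb)
  | @hpr p i hp =>
    refine ⟨(Finset.range (i + 1)).image fun j => normalize p ^ j, fun a ha hax => ?_, ?_⟩
    · obtain ⟨j, hj, hja⟩ := (dvd_prime_pow hp i).1 hax
      refine Finset.mem_image.2 ⟨j, Finset.mem_range.2 (by omega), ?_⟩
      exact eq_of_monic_of_associated ((monic_normalize hp.ne_zero).pow j) ha
        (((normalize_associated p).pow_pow).trans hja.symm)
    · have hcard : ((((Finset.range (i + 1)).image fun j => normalize p ^ j).card : ℕ) : ℝ) ≤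
          i + 1 := by
        exact_mod_cast Finset.card_image_le.trans (Finset.card_range _).le
      refine hcard.trans ?_
      rw [natDegree_pow]
      have hdeg : 1 ≤ p.natDegree := hp.irreducible.natDegree_pos
      rcases Nat.eq_zero_or_pos i with rfl | hi
      · simpa using one_le_pow₀ hN'
      · by_cases hpN : N ≤ p.natDegree
        -- For a prime of degree at least `N`, the exponential of the degree alone absorbs `2 ^ i`.
        · calc (i + 1 : ℝ) ≤ 2 ^ i := by exact_mod_cast Nat.lt_two_pow_self
            _ ≤ ((1 + 1 / (N : ℝ)) ^ N) ^ i := by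
              gcongr
              exact two_le_one_add_inv_pow hN
            _ = (1 + 1 / (N : ℝ)) ^ (i * N) := by rw [← pow_mul, mul_comm]
            _ ≤ (1 + 1 / (N : ℝ)) ^ (i * p.natDegree) :=
              pow_le_pow_right₀ hb (Nat.mul_le_mul_left _ hpN)
            _ ≤ _ := le_mul_of_one_le_left (by positivity) (one_le_pow₀ hN')
        · have hmem : normalize p ∈ smallFactors N (p ^ i) := by
            refine mem_smallFactors.2 ⟨?_, monic_normalize hp.ne_zero,
              (normalize_associated p).symm.prime hp, ?_⟩
            · rw [mem_degreeLT, degree_normalize, degree_eq_natDegree hp.ne_zero]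
              exact_mod_cast not_le.1 hpN
            · exact (normalize_associated p).dvd.trans (dvd_pow_self p hi.ne')
          calc (i + 1 : ℝ) ≤ N * (1 + 1 / (N : ℝ)) ^ i := succ_le_mul_one_add_inv_pow hN i
            _ ≤ _ := by
              gcongr ?_ * ?_
              · exact le_self_pow₀ hN' (Finset.card_pos.2 ⟨_, hmem⟩).ne'
              · exact pow_le_pow_right₀ hb (Nat.le_mul_of_pos_right _ hdeg)
  | @hcp x y hxy ihx ihy =>
    obtain ⟨hx, hy⟩ := mul_ne_zero_iff.1 hc
    obtain ⟨S, hS, hS'⟩ := ihx hx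
    obtain ⟨T, hT, hT'⟩ := ihy hy
    refine ⟨Finset.image₂ (· * ·) S T, fun a ha hax => ?_, ?_⟩
    · obtain ⟨b, d, hb, hd, rfl⟩ := exists_dvd_and_dvd_of_dvd_mul hax
      have hb0 := ne_zero_of_dvd_ne_zero hx hb
      have hd0 := ne_zero_of_dvd_ne_zero hy hd
      refine Finset.mem_image₂.2 ⟨normalize b, hS _ (monic_normalize hb0)
        ((normalize_associated b).dvd.trans hb), normalize d, hT _ (monic_normalize hd0)
        ((normalize_associated d).dvd.trans hd), ?_⟩
      exact eq_of_monic_of_associated ((monic_normalize hb0).mul (monic_normalize hd0)) ha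
        ((normalize_associated b).mul_mul (normalize_associated d))
    · calc ((Finset.image₂ (· * ·) S T).card : ℝ) ≤ S.card * T.card := by
            exact_mod_cast Finset.card_image₂_le _ _ _
        _ ≤ _ := mul_le_mul hS' hT' (by positivity) (by positivity)
        _ = (N : ℝ) ^ ((smallFactors N x).card + (smallFactors N y).card) *
              (1 + 1 / (N : ℝ)) ^ (x * y).natDegree := by
            rw [natDegree_mul hx hy, pow_add, pow_add]
            ring
        _ ≤ _ := by
            gcongr
            exact card_smallFactors_mul_of_isRelPrime N hxy

/-- The divisor bound for polynomials over a finite field. -/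
theorem exists_finset_dvd_card_le {N : ℕ} (hN : 1 ≤ N) {c : k[X]} (hc : c ≠ 0) :
    ∃ T : Finset k[X], (∀ a : k[X], a ∣ c → a ∈ T) ∧
      (T.card : ℝ) ≤ Fintype.card k * ((N : ℝ) ^ (Fintype.card k ^ N) *
        (1 + 1 / (N : ℝ)) ^ c.natDegree) := by
  classical
  obtain ⟨T, hT, hT'⟩ := exists_finset_monic_dvd_card_le_smallFactors hN c hc
  refine ⟨Finset.image₂ (fun (u : k) a => C u * a) Finset.univ T, fun a ha => ?_, ?_⟩
  · have ha0 := ne_zero_of_dvd_ne_zero hc ha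
    refine Finset.mem_image₂.2 ⟨a.leadingCoeff, Finset.mem_univ _, normalize a,
      hT _ (monic_normalize ha0) ((normalize_associated a).dvd.trans ha), ?_⟩
    rw [normalize_apply, coe_normUnit_of_ne_zero ha0, mul_left_comm, ← C_mul,
      mul_inv_cancel₀ (leadingCoeff_ne_zero.2 ha0), C_1, mul_one]
  · calc _ ≤ (Fintype.card k : ℝ) * T.card := by
          have h := Finset.card_image₂_le (fun (u : k) a => C u * a) Finset.univ T
          rw [Finset.card_univ] at h
          exact_mod_cast h
      _ ≤ _ := by
          gcongr
          refine hT'.trans ?_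
          gcongr
          · exact_mod_cast hN
          · exact card_smallFactors_le N c

end Divisors

/-! ### Sequences as functionals on polynomials. -/

section Functional

variable {k : Type*} [Field k] {n : ℕ}

/-- The linear functional on polynomials sending `X ^ l` to `x l` for `l ≤ n`
and to `0` for `l > n`. -/
def functional (x : Fin (n + 1) → k) : k[X] →ₗ[k] k :=
  ∑ l : Fin (n + 1), x l • lcoeff k l

theorem functional_apply (x : Fin (n + 1) → k) (f : k[X]) :
    functional x f = ∑ l : Fin (n + 1), f.coeff l * x l := by
  simp [functional, mul_comm]

theorem functional_monomial (x : Fin (n + 1) → k) {e : ℕ} (he : e < n + 1) (c : k) :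
    functional x (monomial e c) = c * x ⟨e, he⟩ := by
  rw [functional_apply, Finset.sum_eq_single ⟨e, he⟩]
  · simp
  · intro l _ hl
    rw [coeff_monomial, if_neg (fun h => hl (Fin.ext h.symm)), zero_mul]
  · simp

theorem functional_mul_X_pow (x : Fin (n + 1) → k) {m j : ℕ} (hj : j + m ≤ n) {a : k[X]}
    (ha : a ∈ degreeLT k (m + 1)) :
    functional x (a * X ^ j) =
      ∑ i : Fin (m + 1), a.coeff i * x ⟨(i : ℕ) + j, by have := i.isLt; omega⟩ := by
  have h : a = ∑ i : Fin (m + 1), monomial i (a.coeff i) :=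
    (a.sum_fin (monomial ·) (by simp) (mem_degreeLT.mp ha)).symm ▸ (a.sum_monomial_eq).symm
  conv_lhs => rw [h]
  rw [Finset.sum_mul, map_sum]
  refine Finset.sum_congr rfl fun i _ => ?_
  rw [monomial_mul_X_pow, functional_monomial]

theorem mem_recursions_functional (x : Fin (n + 1) → k) {m r : ℕ} (hr : m + r = n + 1) {a : k[X]} :
    a ∈ recursions (functional x) (m + 1) r ↔ a ∈ degreeLT k (m + 1) ∧
      ∀ (j : ℕ) (hj : j + m ≤ n),
        ∑ i : Fin (m + 1), a.coeff i * x ⟨(i : ℕ) + j, by have := i.isLt; omega⟩ = 0 := by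
  classical
  rw [mem_recursions]
  refine and_congr_right fun ha => ⟨fun h j hj => ?_, fun h b hb => ?_⟩
  · rw [← functional_mul_X_pow x hj ha]
    exact h _ (mem_degreeLT.2 (by rw [degree_X_pow]; norm_cast; omega))
  · rw [degreeLT_eq_span_X_pow] at hb
    induction hb using Submodule.span_induction with
    | mem b hb =>
      obtain ⟨j, hj, rfl⟩ := Finset.mem_image.1 (Finset.mem_coe.1 hb)
      have := Finset.mem_range.1 hj
      rw [functional_mul_X_pow x (by omega) ha]
      exact h j (by omega)
    | zero => simp
    | add b c _ _ hb hc => rw [mul_add, map_add, hb, hc, add_zero]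
    | smul t b _ hb => rw [mul_smul_comm, map_smul, hb, smul_zero]

theorem mem_H_iff (x : Fin (n + 1) → k) {m r : ℕ} (hr : m + r = n + 1) :
    x ∈ H k m n ↔ finrank k (recursions (functional x) (m + 1) r) ≠ 0 := by
  rw [Ne, Submodule.finrank_eq_zero, ← Ne, Submodule.ne_bot_iff]
  constructor
  · rintro ⟨a, ha0, ha⟩
    let b := (degreeLTEquiv k (m + 1)).symm a
    have hb : ∀ i : Fin (m + 1), (b : k[X]).coeff i = a i := fun i =>
      congrFun ((degreeLTEquiv k (m + 1)).apply_symm_apply a) i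
    refine ⟨b, (mem_recursions_functional x hr).2 ⟨b.2, fun j hj => ?_⟩, fun h => ha0 ?_⟩
    · simpa only [hb] using ha j hj
    · ext i
      rw [← hb, h]
      simp
  · rintro ⟨b, hb, hb0⟩
    obtain ⟨hb1, hb2⟩ := (mem_recursions_functional x hr).1 hb
    refine ⟨fun i => b.coeff i, fun h => hb0 ?_, hb2⟩
    ext i
    by_cases hi : i < m + 1
    · exact congrFun h ⟨i, hi⟩
    · exact coeff_eq_zero_of_degree_lt ((mem_degreeLT.1 hb1).trans_le
        (by norm_cast; omega))

end Functional

/-! ### Detecting `H_m` by additive characters. -/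

section CharacterSums

variable {k : Type*} [Field k] {ψ : AddChar k Circle}

open Classical in
theorem sum_char_linearMap (hψ : ψ ≠ 1) {V : Type*} [AddCommGroup V] [Module k V] [Fintype V]
    (g : V →ₗ[k] k) : ∑ v, (ψ (g v) : ℂ) = if g = 0 then (Fintype.card V : ℂ) else 0 := by
  let χ : AddChar V ℂ := (Circle.coeHom.compAddChar ψ).compAddMonoidHom g.toAddMonoidHom
  have hχ : ∀ v, χ v = (ψ (g v) : ℂ) := fun _ => rfl
  have h := AddChar.sum_eq_ite χ
  simp only [hχ] at h
  rw [h]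
  congr 1
  rw [eq_iff_iff]
  refine ⟨fun h0 => ?_, fun h0 => ?_⟩
  · by_contra hg
    obtain ⟨v, hv⟩ : ∃ v, g v ≠ 0 := by
      by_contra! hv
      exact hg (LinearMap.ext hv)
    refine hψ (DFunLike.ext _ _ fun y => ?_)
    -- The vector `(y / g v) • v` is sent by `g` to the arbitrary scalar `y`.
    have := congrArg (fun f : AddChar V ℂ => f ((y / g v) • v)) h0
    simp only [hχ, map_smul, smul_eq_mul, div_mul_cancel₀ _ hv] at this
    exact Circle.ext (by simpa using this)
  · ext v
    simp [hχ, h0]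

variable [Fintype k]

-- The sum over `b` vanishes unless `a` is a recursion, so the double sum counts the nonzero
-- recursions.
open Classical in
theorem sum_sum_char_functional (hψ : ψ ≠ 1) (Λ : k[X] →ₗ[k] k) (p r : ℕ) :
    ∑ a ∈ Finset.univ.erase (0 : degreeLT k p), ∑ b : degreeLT k r, (ψ (Λ (a * b)) : ℂ) =
      (Fintype.card k : ℂ) ^ r *
        ((Fintype.card k : ℂ) ^ finrank k (recursions Λ p r) - 1) := by
  have h : ∀ a : degreeLT k p, ∑ b : degreeLT k r, (ψ (Λ (a * b)) : ℂ) =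
      if pairing Λ p r a = 0 then (Fintype.card k : ℂ) ^ r else 0 := by
    intro a
    have := sum_char_linearMap hψ (pairing Λ p r a)
    simp only [pairing_apply] at this
    rw [this, card_degreeLT, Nat.cast_pow]
  have hcard : (Finset.univ.filter fun a => pairing Λ p r a = 0).card =
      Fintype.card k ^ finrank k (recursions Λ p r) := by
    have h := Module.card_eq_pow_finrank (K := k) (V := LinearMap.ker (pairing Λ p r))
    rw [recursions, Submodule.finrank_map_subtype_eq, ← h, Fintype.card_subtype]
    simp only [LinearMap.mem_ker]
  have hsum := Finset.add_sum_erase Finset.univ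
    (fun a : degreeLT k p => ∑ b : degreeLT k r, (ψ (Λ (a * b)) : ℂ)) (Finset.mem_univ 0)
  rw [← eq_sub_iff_add_eq'] at hsum
  rw [hsum, h 0, map_zero, if_pos rfl, Finset.sum_congr rfl fun a _ => h a, ← Finset.sum_filter,
    Finset.sum_const, hcard]
  simp
  ring

open Classical in
theorem indicator_H_eq_sum_char (hψ : ψ ≠ 1) {m n r : ℕ} (hr : m + r = n + 1) (hmr : m ≤ r)
    (x : Fin (n + 1) → k) :
    ((Fintype.card k : ℂ) - 1) * (Fintype.card k : ℂ) ^ r * (if x ∈ H k m n then 1 else 0) =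
      ∑ a ∈ Finset.univ.erase (0 : degreeLT k (m + 1)), ∑ b : degreeLT k r,
        (ψ (functional x (a * b)) : ℂ) -
      ∑ a ∈ Finset.univ.erase (0 : degreeLT k m), ∑ b : degreeLT k (r + 1),
        (ψ (functional x (a * b)) : ℂ) := by
  rw [sum_sum_char_functional hψ, sum_sum_char_functional hψ, mem_H_iff x hr]
  split_ifs with h
  · rw [finrank_recursions_succ _ hmr h]
    ring
  · rw [not_not] at h
    have h' := Submodule.finrank_mono (recursions_mono (functional x) m r)
    rw [h, Nat.le_zero] at h'
    rw [h, h']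
    ring

end CharacterSums

/-! ### Averaging over the distributions; main term and error. -/

section FourierBound

variable {k : Type*} [Field k] [Fintype k] {n : ℕ}

/-- The Fourier transform of a product function at the coefficient vector of a polynomial. -/
def fourierProd (ψ : AddChar k Circle) (μ : Fin (n + 1) → k → ℝ) (c : k[X]) : ℂ :=
  ∏ l : Fin (n + 1), fourier ψ (fun x => (μ l x : ℂ)) (c.coeff l)

theorem fourier_zero (ψ : AddChar k Circle) {μ : k → ℝ} (hμ : IsDistribution μ) :
    fourier ψ (fun x => (μ x : ℂ)) 0 = 1 := by
  simp only [fourier, zero_mul, AddChar.map_zero_eq_one, Circle.coe_one, mul_one]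
  exact_mod_cast hμ.sum_eq_one

theorem one_le_fourierL1 (ψ : AddChar k Circle) {μ : k → ℝ} (hμ : IsDistribution μ) :
    1 ≤ fourierL1 ψ μ := by
  calc (1 : ℝ) = ‖fourier ψ (fun x => (μ x : ℂ)) 0‖ := by rw [fourier_zero ψ hμ, norm_one]
    _ ≤ _ := Finset.single_le_sum (f := fun a => ‖fourier ψ (fun x => (μ x : ℂ)) a‖)
        (fun a _ => norm_nonneg _) (Finset.mem_univ 0)

variable (ψ : AddChar k Circle) (μ : Fin (n + 1) → k → ℝ)

theorem sum_prod_mul_char (c : k[X]) :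
    ∑ x : Fin (n + 1) → k, (∏ i, (μ i (x i) : ℂ)) * (ψ (functional x c) : ℂ) =
      fourierProd ψ μ c := by
  simp only [fourierProd, fourier]
  rw [Finset.prod_univ_sum, Fintype.piFinset_univ]
  refine Finset.sum_congr rfl fun x _ => ?_
  rw [Finset.prod_mul_distrib, functional_apply]
  congr 1
  have h : ∀ (s : Finset (Fin (n + 1))) (g : Fin (n + 1) → k),
      (ψ (∑ l ∈ s, g l) : ℂ) = ∏ l ∈ s, (ψ (g l) : ℂ) := by
    intro s g
    induction s using Finset.cons_induction with
    | empty => simp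
    | cons l s hl ih =>
      rw [Finset.sum_cons, Finset.prod_cons, AddChar.map_add_eq_mul, Circle.coe_mul, ih]
  exact h _ _

theorem sum_norm_fourierProd :
    ∑ c : degreeLT k (n + 1), ‖fourierProd ψ μ c‖ = ∏ i, fourierL1 ψ (μ i) := by
  simp only [fourierL1]
  rw [Finset.prod_univ_sum, Fintype.piFinset_univ,
    ← Equiv.sum_comp (degreeLTEquiv k (n + 1)).toEquiv]
  refine Finset.sum_congr rfl fun c _ => ?_
  rw [fourierProd, norm_prod]
  rfl

-- Group the pairs by their product `c`; each fiber injects into the divisors of `c` through its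
-- first component.
open Classical in
theorem norm_sum_fourierProd_le {N : ℕ} (hN : 1 ≤ N) {p r : ℕ} (hpr : p + r = n + 2) :
    ‖∑ a ∈ Finset.univ.erase (0 : degreeLT k p), ∑ b ∈ Finset.univ.erase (0 : degreeLT k r),
      fourierProd ψ μ (a * b)‖ ≤
    Fintype.card k * ((N : ℝ) ^ (Fintype.card k ^ N) * (1 + 1 / (N : ℝ)) ^ n) *
      ∏ i, fourierL1 ψ (μ i) := by
  set K : ℝ := Fintype.card k * ((N : ℝ) ^ (Fintype.card k ^ N) * (1 + 1 / (N : ℝ)) ^ n) with hK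
  have hK0 : 0 ≤ K := by positivity
  let φ : degreeLT k p × degreeLT k r → degreeLT k (n + 1) := fun ab =>
    ⟨ab.1 * ab.2, mul_mem_degreeLT (by omega) ab.1.2 ab.2.2⟩
  set s := Finset.univ.erase (0 : degreeLT k p) ×ˢ Finset.univ.erase (0 : degreeLT k r) with hs
  have hfiber : ∀ c : degreeLT k (n + 1), ((s.filter fun ab => φ ab = c).card : ℝ) ≤ K := by
    intro c
    rcases eq_or_ne c 0 with rfl | hc
    -- Removing zero from both factors empties the fiber over 0, where a divisor bound would fail.
    · rw [Finset.filter_false_of_mem, Finset.card_empty, Nat.cast_zero]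
      · exact hK0
      · rintro ⟨a, b⟩ hab h
        simp only [hs, Finset.mem_product, Finset.mem_erase] at hab
        have := congrArg Subtype.val h
        rcases mul_eq_zero.1 this with h | h
        · exact hab.1.1 (Subtype.ext h)
        · exact hab.2.1 (Subtype.ext h)
    · have hc0 : (c : k[X]) ≠ 0 := fun h => hc (Subtype.ext h)
      obtain ⟨T, hT, hT'⟩ := exists_finset_dvd_card_le hN hc0
      have hcard : (s.filter fun ab => φ ab = c).card ≤ T.card := by
        refine Finset.card_le_card_of_injOn (fun ab => (ab.1 : k[X])) ?_ ?_
        · rintro ⟨a, b⟩ hab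
          have hab := (Finset.mem_filter.1 hab).2
          exact hT _ ⟨b, (congrArg Subtype.val hab).symm⟩
        · rintro ⟨a, b⟩ hab ⟨a', b'⟩ hab' h
          have h1 : (a : k[X]) * b = c := congrArg Subtype.val (Finset.mem_filter.1 hab).2
          have h2 : (a' : k[X]) * b' = c := congrArg Subtype.val (Finset.mem_filter.1 hab').2
          have h : (a : k[X]) = a' := h
          rw [← h, ← h1] at h2
          have ha : (a : k[X]) ≠ 0 := by
            rintro ha
            rw [ha, zero_mul] at h1
            exact hc0 h1.symm
          exact Prod.ext (Subtype.ext h) (Subtype.ext (mul_left_cancel₀ ha h2).symm)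
      have hdeg : (c : k[X]).natDegree ≤ n := by
        have := c.2
        rw [mem_degreeLT, degree_eq_natDegree hc0] at this
        norm_cast at this
        omega
      calc ((s.filter fun ab => φ ab = c).card : ℝ) ≤ T.card := by exact_mod_cast hcard
        _ ≤ _ := hT'
        _ ≤ K := by
          rw [hK]
          gcongr
          have : 0 ≤ 1 / (N : ℝ) := by positivity
          linarith
  calc _ = ‖∑ ab ∈ s, fourierProd ψ μ (φ ab)‖ := by rw [hs, Finset.sum_product]
    _ ≤ ∑ ab ∈ s, ‖fourierProd ψ μ (φ ab)‖ := norm_sum_le _ _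
    _ = ∑ c : degreeLT k (n + 1), ∑ ab ∈ s with φ ab = c, ‖fourierProd ψ μ (φ ab)‖ :=
        (Finset.sum_fiberwise _ _ _).symm
    _ ≤ ∑ c : degreeLT k (n + 1), K * ‖fourierProd ψ μ c‖ := by
        refine Finset.sum_le_sum fun c _ => ?_
        rw [Finset.sum_congr rfl (g := fun _ => ‖fourierProd ψ μ c‖)
          fun ab hab => by rw [(Finset.mem_filter.1 hab).2], Finset.sum_const, nsmul_eq_mul]
        exact mul_le_mul_of_nonneg_right (hfiber c) (norm_nonneg _)
    _ = _ := by rw [← Finset.mul_sum, sum_norm_fourierProd]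

-- Isolates the terms with `b = 0`, each equal to 1 because the weights have total mass 1.
open Classical in
theorem sum_sum_fourierProd_eq (hμ : ∀ i, IsDistribution (μ i)) (p r : ℕ) :
    ∑ a ∈ Finset.univ.erase (0 : degreeLT k p), ∑ b : degreeLT k r, fourierProd ψ μ (a * b) =
      ((Fintype.card k : ℂ) ^ p - 1) +
      ∑ a ∈ Finset.univ.erase (0 : degreeLT k p), ∑ b ∈ Finset.univ.erase (0 : degreeLT k r),
        fourierProd ψ μ (a * b) := by
  have h0 : fourierProd ψ μ 0 = 1 := by simp [fourierProd, fourier_zero ψ (hμ _)]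
  have h : ∀ a : degreeLT k p, ∑ b : degreeLT k r, fourierProd ψ μ (a * b) =
      1 + ∑ b ∈ Finset.univ.erase (0 : degreeLT k r), fourierProd ψ μ (a * b) := by
    intro a
    rw [← Finset.add_sum_erase _ _ (Finset.mem_univ 0)]
    simp [h0]
  rw [Finset.sum_congr rfl fun a _ => h a, Finset.sum_add_distrib, Finset.sum_const,
    Finset.card_erase_of_mem (Finset.mem_univ _), Finset.card_univ, card_degreeLT, nsmul_eq_mul,
    mul_one, Nat.cast_sub (Nat.one_le_pow _ _ Fintype.card_pos)]
  push_cast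
  rfl

open Classical in
theorem prob_H_eq (hψ : ψ ≠ 1) {m r : ℕ} (hr : m + r = n + 1) (hmr : m ≤ r) :
    ((Fintype.card k : ℂ) - 1) * (Fintype.card k : ℂ) ^ r * (prob μ (H k m n) : ℂ) =
      ∑ a ∈ Finset.univ.erase (0 : degreeLT k (m + 1)), ∑ b : degreeLT k r,
        fourierProd ψ μ (a * b) -
      ∑ a ∈ Finset.univ.erase (0 : degreeLT k m), ∑ b : degreeLT k (r + 1),
        fourierProd ψ μ (a * b) := by
  have h1 : (prob μ (H k m n) : ℂ) = ∑ x : Fin (n + 1) → k, (∏ i, (μ i (x i) : ℂ)) *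
      (if x ∈ H k m n then 1 else 0) := by
    simp only [prob, Set.indicator_apply]
    push_cast
    refine Finset.sum_congr rfl fun x _ => ?_
    split_ifs <;> simp
  have h2 : ∀ p s : ℕ, ∑ a ∈ Finset.univ.erase (0 : degreeLT k p), ∑ b : degreeLT k s,
        fourierProd ψ μ (a * b) =
      ∑ x : Fin (n + 1) → k, (∏ i, (μ i (x i) : ℂ)) *
        ∑ a ∈ Finset.univ.erase (0 : degreeLT k p), ∑ b : degreeLT k s,
          (ψ (functional x (a * b)) : ℂ) := by
    intro p s
    simp only [← sum_prod_mul_char, Finset.mul_sum]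
    symm
    rw [Finset.sum_comm]
    exact Finset.sum_congr rfl fun a _ => Finset.sum_comm
  rw [h1, h2, h2, Finset.mul_sum, ← Finset.sum_sub_distrib]
  refine Finset.sum_congr rfl fun x _ => ?_
  rw [← mul_sub, ← indicator_H_eq_sum_char hψ hr hmr]
  ring

theorem abs_prob_H_sub_le (hψ : ψ ≠ 1) (hμ : ∀ i, IsDistribution (μ i)) {N : ℕ} (hN : 1 ≤ N)
    {m r : ℕ} (hr : m + r = n + 1) (hmr : m ≤ r) :
    (Fintype.card k : ℝ) ^ r *
      |prob μ (H k m n) - (Fintype.card k : ℝ) ^ m / (Fintype.card k : ℝ) ^ r| ≤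
    2 * (Fintype.card k * ((N : ℝ) ^ (Fintype.card k ^ N) * (1 + 1 / (N : ℝ)) ^ n) *
      ∏ i, fourierL1 ψ (μ i)) := by
  classical
  have hq : (2 : ℝ) ≤ Fintype.card k := by exact_mod_cast Fintype.one_lt_card (α := k)
  have hqC : (Fintype.card k : ℂ) ≠ 0 := by exact_mod_cast Fintype.card_ne_zero
  have h := prob_H_eq ψ μ hψ hr hmr
  rw [sum_sum_fourierProd_eq ψ μ hμ, sum_sum_fourierProd_eq ψ μ hμ] at h
  have b1 := norm_sum_fourierProd_le ψ μ hN (p := m + 1) (r := r) (by omega)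
  have b2 := norm_sum_fourierProd_le ψ μ hN (p := m) (r := r + 1) (by omega)
  set E₁ := ∑ a ∈ Finset.univ.erase (0 : degreeLT k (m + 1)),
    ∑ b ∈ Finset.univ.erase (0 : degreeLT k r), fourierProd ψ μ (a * b)
  set E₂ := ∑ a ∈ Finset.univ.erase (0 : degreeLT k m),
    ∑ b ∈ Finset.univ.erase (0 : degreeLT k (r + 1)), fourierProd ψ μ (a * b)
  set q : ℝ := (Fintype.card k : ℝ) with hqdef
  set P := prob μ (H k m n)
  have h3 : (((q - 1) * (q ^ r * (P - q ^ m / q ^ r)) : ℝ) : ℂ) = E₁ - E₂ := by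
    have : E₁ - E₂ = ((Fintype.card k : ℂ) - 1) * (Fintype.card k : ℂ) ^ r * P -
        (((Fintype.card k : ℂ) ^ (m + 1) - 1) - ((Fintype.card k : ℂ) ^ m - 1)) := by
      rw [h]
      ring
    rw [this, hqdef]
    push_cast
    field_simp
    ring
  have h4 : (q - 1) * (q ^ r * |P - q ^ m / q ^ r|) ≤ ‖E₁‖ + ‖E₂‖ := by
    calc (q - 1) * (q ^ r * |P - q ^ m / q ^ r|) = ‖E₁ - E₂‖ := by
          rw [← h3, Complex.norm_real, Real.norm_eq_abs, abs_mul, abs_mul,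
            abs_of_nonneg (show 0 ≤ q - 1 by linarith), abs_of_nonneg (show 0 ≤ q ^ r by positivity)]
      _ ≤ _ := norm_sub_le _ _
  -- The factor `q - 1 ≥ 1` may be dropped.
  have h5 : q ^ r * |P - q ^ m / q ^ r| ≤ (q - 1) * (q ^ r * |P - q ^ m / q ^ r|) :=
    le_mul_of_one_le_left (by positivity) (by linarith)
  linarith

/-- The constant in the equidistribution bound, as a function of the order of the field
and of `N ≥ 1 / ε`. -/
def boundConst (q N : ℕ) : ℕ := 2 * N ^ q ^ N + 1

theorem abs_prob_H_sub_lt (hψ : ψ ≠ 1) (hμ : ∀ i, IsDistribution (μ i)) {ε : ℝ} (hε : 0 < ε)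
    {N : ℕ} (hN : 1 ≤ (N : ℝ) * ε) {m : ℕ} (hm : 2 * m ≤ n + 1) :
    |prob μ (H k m n) - (Fintype.card k : ℝ) ^ (2 * (m : ℤ) - ((n : ℤ) + 1))| <
      (boundConst (Fintype.card k) N : ℝ) * (1 + ε) ^ n *
        (Fintype.card k : ℝ) ^ ((m : ℤ) - (n : ℤ)) * ∏ i, fourierL1 ψ (μ i) := by
  obtain ⟨r, hr⟩ := Nat.exists_eq_add_of_le (show m ≤ n + 1 by omega)
  have hN1 : 1 ≤ N := by
    rcases Nat.eq_zero_or_pos N with rfl | h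
    · norm_num at hN
    · exact h
  have hN0 : (0 : ℝ) < N := by exact_mod_cast hN1
  have hNε : 1 / (N : ℝ) ≤ ε := by rwa [div_le_iff₀' hN0]
  have h := abs_prob_H_sub_le ψ μ hψ hμ hN1 hr.symm (by omega)
  have hq : (0 : ℝ) < Fintype.card k := by exact_mod_cast Fintype.card_pos
  have hprod : 0 < ∏ i, fourierL1 ψ (μ i) :=
    Finset.prod_pos fun i _ => zero_lt_one.trans_le (one_le_fourierL1 ψ (hμ i))
  have e1 : (Fintype.card k : ℝ) ^ (2 * (m : ℤ) - ((n : ℤ) + 1)) =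
      (Fintype.card k : ℝ) ^ m / (Fintype.card k : ℝ) ^ r := by
    rw [← zpow_natCast, ← zpow_natCast, ← zpow_sub₀ hq.ne']
    congr 1
    omega
  have e2 : (Fintype.card k : ℝ) ^ ((m : ℤ) - (n : ℤ)) =
      (Fintype.card k : ℝ) / (Fintype.card k : ℝ) ^ r := by
    rw [← zpow_natCast, div_eq_mul_inv, ← zpow_neg, ← zpow_one_add₀ hq.ne']
    congr 1
    omega
  rw [e1, e2, ← mul_lt_mul_iff_right₀ (pow_pos hq r)]
  refine h.trans_lt ?_
  set M := ∏ i, fourierL1 ψ (μ i)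
  calc _ ≤ 2 * (Fintype.card k * ((N : ℝ) ^ (Fintype.card k ^ N) * (1 + ε) ^ n) * M) := by
        gcongr
    -- The `+ 1` in `boundConst` supplies this positive term and makes the inequality strict; the 2
    -- counts the two error sums.
    _ < 2 * (Fintype.card k * ((N : ℝ) ^ (Fintype.card k ^ N) * (1 + ε) ^ n) * M) +
        Fintype.card k * (1 + ε) ^ n * M := lt_add_of_pos_right _ (by positivity)
    _ = _ := by
        rw [boundConst]
        push_cast
        field_simp

theorem computable_boundConst : Computable₂ boundConst := by
  have hpow : Primrec₂ ((· ^ ·) : ℕ → ℕ → ℕ) := Primrec₂.unpaired'.1 Nat.Primrec.pow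
  have h : Primrec₂ boundConst := by
    refine Primrec.nat_add.comp (Primrec.nat_mul.comp (Primrec.const 2) ?_) (Primrec.const 1)
    exact hpow.comp Primrec.snd (hpow.comp Primrec.fst Primrec.snd)
  exact h.to_comp

end FourierBound

/-! ### The limit for a fixed distribution. -/

section Limit

variable {k : Type*} [Field k]

theorem setOf_det_hankel_eq_zero (m : ℕ) :
    {x : Fin (2 * m + 1) → k | (hankel m x).det = 0} = H k m (2 * m) := by
  ext x
  rw [Set.mem_ofPred_eq, ← Matrix.exists_vecMul_eq_zero_iff]
  refine exists_congr fun a => and_congr_right fun _ => ?_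
  constructor
  · intro h j hj
    exact congrFun h ⟨j, by omega⟩
  · intro h
    ext j
    exact h j (by have := j.isLt; omega)

variable [Fintype k] {ψ : AddChar k Circle}

theorem tendsto_prob_H (hψ : ψ ≠ 1) {μ : k → ℝ} (hμ : IsDistribution μ)
    (hlt : fourierL1 ψ μ < Real.sqrt (Fintype.card k)) (α : ℕ) :
    Filter.Tendsto (fun m : ℕ => prob (fun _ => μ) (H k m (2 * m + α))) Filter.atTop
      (nhds (((Fintype.card k : ℝ) ^ (α + 1))⁻¹)) := by
  set q : ℝ := (Fintype.card k : ℝ) with hq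
  have hq0 : 0 < q := Nat.cast_pos.2 Fintype.card_pos
  set M := fourierL1 ψ μ
  have hM : 1 ≤ M := one_le_fourierL1 ψ hμ
  obtain ⟨ε, hε, hεM⟩ : ∃ ε : ℝ, 0 < ε ∧ (1 + ε) * M < Real.sqrt q := by
    -- This choice makes `(1 + ε) * M` the midpoint of `M` and `√q`, so that the ratio `ρ` of the
    -- geometric error bound is below 1.
    refine ⟨(Real.sqrt q - M) / (2 * M), by apply div_pos <;> linarith, ?_⟩
    field_simp
    linarith
  obtain ⟨N, hN⟩ := exists_nat_ge (1 / ε)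
  rw [div_le_iff₀ hε] at hN
  set ρ := ((1 + ε) * M) ^ 2 / q
  have hρ0 : 0 ≤ ρ := by positivity
  have hρ : ρ < 1 := by
    rw [div_lt_one hq0, ← Real.lt_sqrt (by positivity)]
    exact hεM
  set K := (boundConst (Fintype.card k) N : ℝ) * (1 + ε) ^ α * M ^ (α + 1) / q ^ α
  have hbound : ∀ m : ℕ, |prob (fun _ => μ) (H k m (2 * m + α)) - (q ^ (α + 1))⁻¹| ≤ K * ρ ^ m := by
    intro m
    have h := abs_prob_H_sub_lt (n := 2 * m + α) ψ (fun _ => μ) hψ (fun _ => hμ) hε hN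
      (m := m) (by omega)
    have e1 : (Fintype.card k : ℝ) ^ (2 * (m : ℤ) - (((2 * m + α : ℕ) : ℤ) + 1)) =
        (q ^ (α + 1))⁻¹ := by
      rw [← zpow_natCast, ← zpow_neg]
      congr 1
      push_cast
      ring
    have e2 : (Fintype.card k : ℝ) ^ ((m : ℤ) - ((2 * m + α : ℕ) : ℤ)) = (q ^ m * q ^ α)⁻¹ := by
      rw [← pow_add, ← zpow_natCast, ← zpow_neg]
      congr 1
      push_cast
      ring
    rw [e1, e2] at h
    refine h.le.trans_eq ?_
    simp only [Finset.prod_const, Finset.card_univ, Fintype.card_fin, K, ρ]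
    rw [div_pow, ← pow_mul, mul_pow]
    field_simp
    ring
  rw [tendsto_iff_norm_sub_tendsto_zero]
  refine squeeze_zero (fun _ => norm_nonneg _) hbound ?_
  simpa using (tendsto_pow_atTop_nhds_zero_of_lt_one hρ0 hρ).const_mul K

end Limit

end LinRec

end

/-- Effectivity of the constant: it is `C q N` for one computable function `C`, where `q` is the
order of the field and `N` is any natural number with `ε ≥ 1 / N`. -/
theorem theorem2 :
    (∃ C : ℕ → ℕ → ℕ, Computable₂ C ∧
      ∀ (k : Type u) [Field k] [Fintype k] (ψ : AddChar k Circle), ψ ≠ 1 →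
      ∀ (ε : ℝ), 0 < ε → ∀ (N : ℕ), 1 ≤ (N : ℝ) * ε →
      ∀ (m n : ℕ), 2 * m ≤ n + 1 →
      ∀ (μ : Fin (n + 1) → k → ℝ), (∀ i, LinRec.IsDistribution (μ i)) →
        |LinRec.prob μ (LinRec.H k m n) - (Fintype.card k : ℝ) ^ (2 * (m : ℤ) - ((n : ℤ) + 1))| <
          (C (Fintype.card k) N : ℝ) * (1 + ε) ^ n * (Fintype.card k : ℝ) ^ ((m : ℤ) - (n : ℤ)) *
            ∏ i, LinRec.fourierL1 ψ (μ i)) ∧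
    (∀ (k : Type u) [Field k] [Fintype k] (ψ : AddChar k Circle), ψ ≠ 1 →
      ∀ (μ : k → ℝ), LinRec.IsDistribution μ →
        LinRec.fourierL1 ψ μ < Real.sqrt (Fintype.card k) →
        (∀ α : ℕ, Filter.Tendsto
          (fun m : ℕ => LinRec.prob (fun _ => μ) (LinRec.H k m (2 * m + α)))
          Filter.atTop (nhds (((Fintype.card k : ℝ) ^ (α + 1))⁻¹))) ∧
        Filter.Tendsto
          (fun m : ℕ => LinRec.prob (fun _ => μ)
            {x : Fin (2 * m + 1) → k | (LinRec.hankel m x).det = 0})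
          Filter.atTop (nhds (1 / (Fintype.card k : ℝ)))) := by
  refine ⟨⟨LinRec.boundConst, LinRec.computable_boundConst, ?_⟩, ?_⟩
  · intro k _ _ ψ hψ ε hε N hN m n hm μ hμ
    exact LinRec.abs_prob_H_sub_lt ψ μ hψ hμ hε hN hm
  · intro k _ _ ψ hψ μ hμ hlt
    refine ⟨LinRec.tendsto_prob_H hψ hμ hlt, ?_⟩
    simp only [LinRec.setOf_det_hankel_eq_zero]
    simpa using LinRec.tendsto_prob_H hψ hμ hlt 0
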